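/- Let $\mathbb{Q}[h_r\mid r>0]$ be the polynomial algebra over $\mathbb{Q}$ in the variables $h_r$, $r\in\mathbb{Z}_{>0}$. For a sequence $a:\mathbb{Z}_{>0}\to\mathbb{Q}$ define elements $\hat h^{\{a\}}_k\in\mathbb{Q}[h_r\mid r>0]$, $k\ge 0$, by $$\sum_{k\ge 0}\hat h^{\{a\}}_k u^k=\exp\Bigl(\sum_{r>0}(-1)^{r-1}\frac{a_r h_r}{r}u^r\Bigr)\in\mathbb{Q}[h_r\mid r>0][[u]].$$ Write $\hat h_k=\hat h^{\{a\}}_k$ for the constant sequence $a_r=1$, and $\bar h_k=\hat h^{\{a\}}_k$ for the sequence with $a_r=1$ if $r$ is even and $a_r=0$ if $r$ is odd. Let $\mathbb{Z}^{(mix)}[h_r\mid r>0]$ be the $\mathbb{Z}$-subalgebra of $\mathbb{Q}[h_r\mid r>0]$ generated by $\{\hat h_r,\bar h_r\mid r>0\}$. Let $c$ be the sequence $c_r=2^{r-1}$, $r>0$. Then $$\hat h^{\{c\}}_k\in\mathbb{Z}^{(mix)}[h_r\mid r>0]\qquad\text{for all } k\ge 0.$$ -/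

import Mathlib

noncomputable section

namespace MixedIntegralForm

/-- The polynomial algebra `ℚ[h_r ∣ r > 0]`; the variable `h_r` is `MvPolynomial.X r`. -/
abbrev PolyAlg : Type := MvPolynomial ℕ+ ℚ

/-- The power series `∑_{r > 0} (-1)^(r-1) (a_r h_r / r) u^r` in `u` over `ℚ[h_r ∣ r > 0]`. -/
def logSeries (a : ℕ+ → ℚ) : PowerSeries PolyAlg :=
  PowerSeries.mk fun n =>
    if hn : 0 < n then
      MvPolynomial.C ((-1 : ℚ) ^ (n - 1) * a ⟨n, hn⟩ / (n : ℚ)) * MvPolynomial.X ⟨n, hn⟩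
    else 0

theorem constantCoeff_logSeries (a : ℕ+ → ℚ) :
    PowerSeries.constantCoeff (logSeries a) = 0 := by
  simp [logSeries, ← PowerSeries.coeff_zero_eq_constantCoeff_apply]

/-- The substitution of `logSeries a` into a power series is meaningful. -/
theorem hasSubst_logSeries (a : ℕ+ → ℚ) : PowerSeries.HasSubst (logSeries a) :=
  PowerSeries.HasSubst.of_constantCoeff_zero' (constantCoeff_logSeries a)

/-- `ĥ^{a}(u) = exp (∑_{r > 0} (-1)^(r-1) (a_r h_r / r) u^r)`. -/
def hatSeries (a : ℕ+ → ℚ) : PowerSeries PolyAlg :=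
  (PowerSeries.exp ℚ).subst (logSeries a)

/-- `ĥ^{a}_k`, the coefficient of `u^k` in `ĥ^{a}(u)`. -/
def hat (a : ℕ+ → ℚ) (k : ℕ) : PolyAlg :=
  PowerSeries.coeff k (hatSeries a)

/-- The constant sequence `1`. -/
def one : ℕ+ → ℚ := fun _ => 1

/-- The sequence `𝟙^(m)`, with value `m` at the multiples of `m` and `0` elsewhere. -/
def oneMult (m : ℕ+) : ℕ+ → ℚ := fun r => if (m : ℕ) ∣ (r : ℕ) then (m : ℚ) else 0

/-- `h̄_k`, the coefficients for the sequence `(1/2) 𝟙^(2)`. -/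
def bar (k : ℕ) : PolyAlg :=
  hat (fun r => (1 / 2 : ℚ) * oneMult 2 r) k

/-- `ℤ^(mix)[h_r ∣ r > 0]`: the `ℤ`-subalgebra of `ℚ[h_r ∣ r > 0]` generated by all
`ĥ_r` and `h̄_r` with `r > 0`. -/
def mix : Subalgebra ℤ PolyAlg :=
  Algebra.adjoin ℤ ({x | ∃ r : ℕ, 0 < r ∧ x = hat one r} ∪ {x | ∃ r : ℕ, 0 < r ∧ x = bar r})

/-- The sequence `c_r = 2^(r-1)`, for `r > 0`. -/
def circ : ℕ+ → ℚ := fun r => 2 ^ ((r : ℕ) - 1)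

end MixedIntegralForm

end

namespace MixedIntegralForm

open PowerSeries Finset

/-! ### Functional equations of the exponential series -/

section Exponential

/-! Write H, B, C for the series of `one`, of the `bar k` and of `circ`. Comparing exponents gives
B(u)² = H(u)H(-u), B(-u) = B(u) and C(u)² = H(2u). Set G = H - B. The first two identities become
B(u)(G(u) + G(-u)) + G(u)G(-u) = 0, whose coefficients in even degree show that the ideal of `mix`
generated by the coefficients of G is closed under x ↦ x²/2 (`half_sq_mem`). It contains ĥ_1, as
h̄_1 = 0, hence all iterated divided squares of ĥ_1. These build a series S over `mix` with S² ≡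
H(2u) modulo 4, up to a term of degree at least 2^k (`approxSqrt_sq`). Writing C = S + 2D and
dividing by 4 leaves D(D + S) = T with T integral below degree 2^k, which is solved for D degree by
degree. -/

theorem exp_subst_eq {A : Type*} [CommRing A] [Algebra ℚ A] {g : PowerSeries A}
    (hg : PowerSeries.HasSubst g) :
    (PowerSeries.exp ℚ).subst g = (PowerSeries.exp A).subst g := by
  ext n
  rw [PowerSeries.coeff_subst' hg, PowerSeries.coeff_subst' hg]
  refine finsum_congr fun d => ?_
  rw [PowerSeries.coeff_exp, PowerSeries.coeff_exp, smul_eq_mul, Algebra.smul_def]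
  rfl

/-- A solution of `f' = f g` is determined by its constant coefficient. -/
theorem eq_of_derivative_eq_mul {A : Type*} [CommRing A] [Algebra ℚ A]
    {f₁ f₂ g : PowerSeries A} (h₁ : d⁄dX A f₁ = f₁ * g) (h₂ : d⁄dX A f₂ = f₂ * g)
    (h : PowerSeries.constantCoeff f₁ = PowerSeries.constantCoeff f₂) : f₁ = f₂ := by
  ext n
  induction n using Nat.strong_induction_on with
  | _ n ih =>
    cases n with
    | zero => simpa using h
    | succ n =>
      have key : PowerSeries.coeff (n + 1) f₁ * ((n : A) + 1)
          = PowerSeries.coeff (n + 1) f₂ * ((n : A) + 1) := by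
        rw [← PowerSeries.coeff_derivative, ← PowerSeries.coeff_derivative, h₁, h₂,
          PowerSeries.coeff_mul, PowerSeries.coeff_mul]
        refine sum_congr rfl fun p hp => ?_
        rw [ih p.1 (by have := mem_antidiagonal.1 hp; omega)]
      have hu : IsUnit ((n : A) + 1) := by
        have : ((n : A) + 1) = algebraMap ℚ A (n + 1) := by simp
        rw [this]
        exact (IsUnit.mk0 _ (by positivity)).map _
      exact hu.mul_left_injective key

theorem derivative_rescale {A : Type*} [CommRing A] (t : A) (f : PowerSeries A) :
    d⁄dX A (PowerSeries.rescale t f)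
      = PowerSeries.C t * PowerSeries.rescale t (d⁄dX A f) := by
  ext n
  simp only [PowerSeries.coeff_derivative, PowerSeries.coeff_rescale, PowerSeries.coeff_C_mul]
  ring

theorem derivative_hatSeries (a : ℕ+ → ℚ) :
    d⁄dX PolyAlg (hatSeries a) = hatSeries a * d⁄dX PolyAlg (logSeries a) := by
  rw [hatSeries, exp_subst_eq (hasSubst_logSeries a),
    PowerSeries.derivative_subst (hasSubst_logSeries a), PowerSeries.derivative_exp]

theorem constantCoeff_hatSeries (a : ℕ+ → ℚ) :
    PowerSeries.constantCoeff (hatSeries a) = 1 := by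
  have h := PowerSeries.constantCoeff_subst_eq_zero (constantCoeff_logSeries a)
    (PowerSeries.exp PolyAlg - 1) (by simp)
  rw [PowerSeries.subst_sub (hasSubst_logSeries a)] at h
  have h1 : (1 : PowerSeries PolyAlg).subst (logSeries a) = (1 : PowerSeries PolyAlg) := by
    rw [← PowerSeries.coe_substAlgHom (hasSubst_logSeries a), map_one]
  rw [h1, ← exp_subst_eq (hasSubst_logSeries a)] at h
  have h2 : PowerSeries.constantCoeff (hatSeries a - 1) = 0 := h
  simpa [sub_eq_zero] using h2

theorem logSeries_add (a b : ℕ+ → ℚ) : logSeries (a + b) = logSeries a + logSeries b := by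
  ext1 n
  rw [map_add]
  simp only [logSeries, PowerSeries.coeff_mk]
  split_ifs with hn
  · rw [← add_mul, ← map_add]
    congr 2
    change (-1 : ℚ) ^ (n - 1) * (a _ + b _) / n = _
    ring
  · simp

theorem hatSeries_add (a b : ℕ+ → ℚ) : hatSeries (a + b) = hatSeries a * hatSeries b := by
  refine eq_of_derivative_eq_mul (derivative_hatSeries _) ?_ ?_
  · rw [Derivation.leibniz, derivative_hatSeries, derivative_hatSeries, logSeries_add, map_add,
      smul_eq_mul, smul_eq_mul]
    ring
  · simp [constantCoeff_hatSeries]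

theorem logSeries_rescale (a : ℕ+ → ℚ) (t : ℚ) :
    logSeries (fun r => t ^ (r : ℕ) * a r)
      = PowerSeries.rescale (MvPolynomial.C t) (logSeries a) := by
  ext1 n
  rw [PowerSeries.coeff_rescale]
  simp only [logSeries, PowerSeries.coeff_mk]
  split_ifs with hn
  · rw [← map_pow, ← mul_assoc (MvPolynomial.C _), ← MvPolynomial.C_mul]
    congr 2
    change (-1 : ℚ) ^ (n - 1) * (t ^ n * a _) / n = _
    ring
  · simp

theorem hatSeries_rescale (a : ℕ+ → ℚ) (t : ℚ) :
    hatSeries (fun r => t ^ (r : ℕ) * a r)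
      = PowerSeries.rescale (MvPolynomial.C t) (hatSeries a) := by
  refine eq_of_derivative_eq_mul (derivative_hatSeries _) ?_ ?_
  · rw [derivative_rescale, derivative_hatSeries, logSeries_rescale, derivative_rescale, map_mul]
    ring
  · rw [constantCoeff_hatSeries, ← PowerSeries.coeff_zero_eq_constantCoeff_apply,
      PowerSeries.coeff_rescale]
    simp [constantCoeff_hatSeries]

end Exponential

/-! ### Quadratic relations between the generating series -/

section Relations

/-- The generating series of the `bar k`. -/
noncomputable def barSeries : PowerSeries PolyAlg := hatSeries fun r => (1 / 2 : ℚ) * oneMult 2 r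

theorem coeff_barSeries (k : ℕ) : PowerSeries.coeff k barSeries = bar k := rfl

theorem coeff_hatSeries (a : ℕ+ → ℚ) (k : ℕ) : PowerSeries.coeff k (hatSeries a) = hat a k := rfl

theorem hat_zero (a : ℕ+ → ℚ) : hat a 0 = 1 := by
  rw [← coeff_hatSeries, PowerSeries.coeff_zero_eq_constantCoeff_apply, constantCoeff_hatSeries]

theorem bar_zero : bar 0 = 1 := hat_zero _

theorem barSeries_mul_self :
    barSeries * barSeries
      = hatSeries one * PowerSeries.rescale (MvPolynomial.C (-1)) (hatSeries one) := by
  rw [← hatSeries_rescale, ← hatSeries_add, barSeries, ← hatSeries_add]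
  congr 1
  ext r
  simp only [Pi.add_apply, oneMult, one]
  rcases Nat.even_or_odd (r : ℕ) with h | h
  · rw [if_pos (by exact h.two_dvd), h.neg_one_pow]
    norm_num
  · rw [if_neg (by exact h.not_two_dvd_nat), h.neg_one_pow]
    norm_num

theorem rescale_neg_one_barSeries :
    PowerSeries.rescale (MvPolynomial.C (-1)) barSeries = barSeries := by
  rw [barSeries, ← hatSeries_rescale]
  congr 1
  ext r
  simp only [oneMult]
  rcases Nat.even_or_odd (r : ℕ) with h | h
  · rw [h.neg_one_pow, one_mul]
  · rw [if_neg (by exact h.not_two_dvd_nat)]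
    simp

theorem hatSeries_circ_mul_self :
    hatSeries circ * hatSeries circ
      = PowerSeries.rescale (MvPolynomial.C 2) (hatSeries one) := by
  rw [← hatSeries_rescale, ← hatSeries_add]
  congr 1
  ext r
  simp only [Pi.add_apply, circ, one]
  obtain ⟨n, hn⟩ := Nat.exists_eq_succ_of_ne_zero r.ne_zero
  rw [hn, Nat.succ_eq_add_one, Nat.add_sub_cancel, pow_succ]
  ring

theorem bar_eq_zero_of_odd {n : ℕ} (h : Odd n) : bar n = 0 := by
  have h1 := congrArg (PowerSeries.coeff n) rescale_neg_one_barSeries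
  rw [PowerSeries.coeff_rescale, coeff_barSeries, ← map_pow, h.neg_one_pow] at h1
  have h2 : bar n = -bar n := by simpa using h1.symm
  exact self_eq_neg.mp h2

/-- The difference between `ĥ_n` and `h̄_n`. -/
noncomputable def diff (n : ℕ) : PolyAlg := hat one n - bar n

/-- This is the coefficient of u^n in B(u)(G(u) + G(-u)) + G(u)G(-u) = 0, with G = H - B. -/
theorem sum_diff_relation (n : ℕ) :
    ∑ p ∈ antidiagonal n, bar p.1 * (diff p.2 + (-1) ^ p.2 * diff p.2)
      + ∑ p ∈ antidiagonal n, diff p.1 * ((-1) ^ p.2 * diff p.2) = 0 := by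
  set G : PowerSeries PolyAlg := hatSeries one - barSeries with hG
  set σ := PowerSeries.rescale (MvPolynomial.C (-1) : PolyAlg) with hσ
  have key : barSeries * (G + σ G) + G * σ G = 0 := by
    have h := barSeries_mul_self
    rw [← hσ, show hatSeries one = barSeries + G by rw [hG]; ring, map_add,
      rescale_neg_one_barSeries] at h
    linear_combination -h
  have hc : ∀ i, PowerSeries.coeff i G = diff i := fun i => by
    rw [hG, map_sub, coeff_barSeries, coeff_hatSeries, diff]
  have h := congrArg (PowerSeries.coeff n) key
  simpa only [map_add, PowerSeries.coeff_mul, hσ, PowerSeries.coeff_rescale, hc, coeff_barSeries,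
    map_neg, map_one, map_zero] using h

end Relations

/-! ### Divided squares in the ideal of differences -/

section DividedSquares

theorem hat_one_mem_mix (n : ℕ) : hat one n ∈ mix := by
  rcases Nat.eq_zero_or_pos n with rfl | h
  · rw [hat_zero]; exact mix.one_mem
  · exact Algebra.subset_adjoin (Or.inl ⟨n, h, rfl⟩)

theorem bar_mem_mix (n : ℕ) : bar n ∈ mix := by
  rcases Nat.eq_zero_or_pos n with rfl | h
  · rw [bar_zero]; exact mix.one_mem
  · exact Algebra.subset_adjoin (Or.inr ⟨n, h, rfl⟩)

theorem diff_mem_mix (n : ℕ) : diff n ∈ mix := mix.sub_mem (hat_one_mem_mix n) (bar_mem_mix n)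

/-- The ideal of `mix` generated by the `diff n`, as a `mix`-submodule of `PolyAlg`. -/
noncomputable def diffIdeal : Submodule mix PolyAlg := Submodule.span mix (Set.range diff)

theorem diff_mem_diffIdeal (n : ℕ) : diff n ∈ diffIdeal := Submodule.subset_span ⟨n, rfl⟩

theorem mul_mem_diffIdeal {r x : PolyAlg} (hr : r ∈ mix) (hx : x ∈ diffIdeal) :
    r * x ∈ diffIdeal :=
  diffIdeal.smul_mem (⟨r, hr⟩ : mix) hx

theorem mem_mix_of_mem_diffIdeal {x : PolyAlg} (hx : x ∈ diffIdeal) : x ∈ mix := by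
  induction hx using Submodule.span_induction with
  | mem x h => obtain ⟨n, rfl⟩ := h; exact diff_mem_mix n
  | zero => exact mix.zero_mem
  | add x y _ _ hx hy => exact mix.add_mem hx hy
  | smul r x _ hx => exact mix.mul_mem r.2 hx

theorem half_mul_two (x : PolyAlg) : MvPolynomial.C (1 / 2 : ℚ) * (2 * x) = x := by
  have : (2 : PolyAlg) = MvPolynomial.C (2 : ℚ) := (map_ofNat MvPolynomial.C 2).symm
  rw [this, ← mul_assoc, ← map_mul]
  norm_num

theorem neg_one_pow_mem_mix (n : ℕ) : (-1 : PolyAlg) ^ n ∈ mix :=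
  mix.pow_mem (mix.neg_mem mix.one_mem) n

theorem sum_antidiagonal_two_mul {M : Type*} [AddCommMonoid M] (n : ℕ) (f : ℕ × ℕ → M)
    (hf : ∀ p, f p.swap = f p) :
    ∑ p ∈ antidiagonal (2 * n), f p = 2 • (∑ i ∈ range n, f (i, 2 * n - i)) + f (n, n) := by
  rw [Finset.Nat.sum_antidiagonal_eq_sum_range_succ_mk, show (2 * n).succ = n + (n + 1) by omega,
    sum_range_add, sum_range_succ', two_nsmul, ← add_assoc, show 2 * n - (n + 0) = n by omega]
  congr 2
  rw [← sum_range_reflect]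
  refine sum_congr rfl fun i hi => ?_
  have := mem_range.1 hi
  rw [← hf]
  exact congrArg f (Prod.ext (by grind) (by grind))

/-- In degree 2n of the quadratic relation every term is paired with an equal one or is already
even, except the middle term ±`diff n ^ 2`; so the latter is twice an element of the ideal. -/
theorem half_sq_diff_mem (n : ℕ) : MvPolynomial.C (1 / 2 : ℚ) * diff n ^ 2 ∈ diffIdeal := by
  have h := sum_diff_relation (2 * n)
  have h1 : ∃ y ∈ diffIdeal,
      ∑ p ∈ antidiagonal (2 * n), bar p.1 * (diff p.2 + (-1) ^ p.2 * diff p.2) = 2 * y := by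
    refine ⟨∑ p ∈ antidiagonal (2 * n), if Even p.2 then bar p.1 * diff p.2 else 0,
      diffIdeal.sum_mem fun p _ => ?_, ?_⟩
    · split_ifs
      · exact mul_mem_diffIdeal (bar_mem_mix _) (diff_mem_diffIdeal _)
      · exact diffIdeal.zero_mem
    · rw [mul_sum]
      refine sum_congr rfl fun p _ => ?_
      rcases Nat.even_or_odd p.2 with h | h
      · rw [if_pos h, h.neg_one_pow]; ring
      · rw [if_neg (Nat.not_even_iff_odd.2 h), h.neg_one_pow]; ring
  obtain ⟨y, hy, hy'⟩ := h1
  have h2 : ∑ p ∈ antidiagonal (2 * n), diff p.1 * ((-1) ^ p.2 * diff p.2)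
      = 2 * (∑ i ∈ range n, (-1) ^ i * diff (2 * n - i) * diff i) + (-1) ^ n * diff n ^ 2 := by
    -- Both indices have the same parity, so the sign may be written with the maximum, which makes
    -- the summand visibly symmetric.
    have e : ∀ p ∈ antidiagonal (2 * n), diff p.1 * ((-1) ^ p.2 * diff p.2)
        = (fun p : ℕ × ℕ => (-1) ^ (max p.1 p.2) * diff p.1 * diff p.2) p := by
      intro p hp
      have hp' := mem_antidiagonal.1 hp
      have : (-1 : PolyAlg) ^ p.2 = (-1) ^ (max p.1 p.2) := by
        rcases max_choice p.1 p.2 with h | h <;> rw [h]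
        refine neg_one_pow_congr ?_
        grind
      rw [this]; ring
    rw [sum_congr rfl e, sum_antidiagonal_two_mul]
    · simp only [max_self, nsmul_eq_mul, Nat.cast_ofNat]
      congr 1
      · congr 1
        refine sum_congr rfl fun i hi => ?_
        have := mem_range.1 hi
        rw [max_eq_right (by omega),
          show (-1 : PolyAlg) ^ (2 * n - i) = (-1) ^ i from neg_one_pow_congr (by grind)]
        ring
      · ring
    · intro p
      simp only [Prod.fst_swap, Prod.snd_swap, max_comm p.2]
      ring
  rw [hy', h2] at h
  set z := ∑ i ∈ range n, (-1) ^ i * diff (2 * n - i) * diff i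
  have hz : z ∈ diffIdeal := diffIdeal.sum_mem fun i _ =>
    mul_mem_diffIdeal (mix.mul_mem (neg_one_pow_mem_mix _) (diff_mem_mix _)) (diff_mem_diffIdeal _)
  have hsq : ((-1 : PolyAlg) ^ n) * (-1) ^ n = 1 := by rw [← mul_pow]; simp
  have h3 : diff n ^ 2 = 2 * (-(-1) ^ n * (y + z)) := by
    linear_combination (-1) ^ n * h - diff n ^ 2 * hsq
  rw [h3, half_mul_two]
  exact mul_mem_diffIdeal (mix.neg_mem (neg_one_pow_mem_mix n)) (diffIdeal.add_mem hy hz)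

/-- The cross term of (x + y)²/2 is xy, with no denominator, so generators suffice. An ideal is
needed: in `mix` itself closure fails at x = 1. -/
theorem half_sq_mem {x : PolyAlg} (hx : x ∈ diffIdeal) :
    MvPolynomial.C (1 / 2 : ℚ) * x ^ 2 ∈ diffIdeal := by
  induction hx using Submodule.span_induction with
  | mem x h => obtain ⟨n, rfl⟩ := h; exact half_sq_diff_mem n
  | zero => simp
  | add x y hx' hy' hx hy =>
    have e : MvPolynomial.C (1 / 2 : ℚ) * (x + y) ^ 2
        = MvPolynomial.C (1 / 2 : ℚ) * x ^ 2 + MvPolynomial.C (1 / 2 : ℚ) * y ^ 2 + x * y := by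
      linear_combination half_mul_two (x * y)
    rw [e]
    exact diffIdeal.add_mem (diffIdeal.add_mem hx hy)
      (mul_mem_diffIdeal (mem_mix_of_mem_diffIdeal hx') hy')
  | smul r x _ hx =>
    have e : MvPolynomial.C (1 / 2 : ℚ) * (r • x) ^ 2
        = ((r : PolyAlg) ^ 2) * (MvPolynomial.C (1 / 2 : ℚ) * x ^ 2) := by
      rw [show r • x = (r : PolyAlg) * x from rfl]; ring
    rw [e]
    exact mul_mem_diffIdeal (mix.pow_mem r.2 2) hx

/-- The iterated divided squares `ĥ_1 ^ (2 ^ k) / 2 ^ (2 ^ k - 1)`. -/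
noncomputable def dividedPow : ℕ → PolyAlg
  | 0 => hat one 1
  | k + 1 => MvPolynomial.C (1 / 2 : ℚ) * dividedPow k ^ 2

theorem dividedPow_sq (k : ℕ) : dividedPow k ^ 2 = 2 * dividedPow (k + 1) := by
  rw [dividedPow, mul_left_comm, half_mul_two]

theorem dividedPow_mem_mix (k : ℕ) : dividedPow k ∈ mix := by
  refine mem_mix_of_mem_diffIdeal ?_
  induction k with
  | zero =>
    have : dividedPow 0 = diff 1 := by
      rw [dividedPow, diff, bar_eq_zero_of_odd odd_one, sub_zero]
    rw [this]
    exact diff_mem_diffIdeal 1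
  | succ k ih => exact half_sq_mem ih

end DividedSquares

/-! ### Square root of H(2u) over the mixed form -/

section SquareRoot

/-- The power series with coefficients in a subring. -/
noncomputable def seriesSubring {A : Type*} [CommRing A] (R : Subring A) : Subring (PowerSeries A) :=
  (PowerSeries.map R.subtype).range

theorem mem_seriesSubring {A : Type*} [CommRing A] {R : Subring A} {f : PowerSeries A} :
    f ∈ seriesSubring R ↔ ∀ n, PowerSeries.coeff n f ∈ R := by
  constructor
  · rintro ⟨g, rfl⟩ n
    rw [PowerSeries.coeff_map]
    exact (PowerSeries.coeff n g).2
  · intro h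
    refine ⟨PowerSeries.mk fun n => ⟨PowerSeries.coeff n f, h n⟩, ?_⟩
    ext n
    simp

/-- If `S` has coefficients in `R` and constant coefficient `1`, then so does, up to degree `N`,
each solution `D` with constant coefficient `0` of `D * (D + S) = T`, when `T` does. -/
theorem coeff_mem_of_mul_add_eq {A : Type*} [CommRing A] (R : Subring A)
    {S D T : PowerSeries A} {N : ℕ} (hS : S ∈ seriesSubring R)
    (hS1 : PowerSeries.constantCoeff S = 1) (hD : PowerSeries.constantCoeff D = 0)
    (hT : ∀ n < N, PowerSeries.coeff n T ∈ R) (h : D * (D + S) = T) :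
    ∀ n < N, PowerSeries.coeff n D ∈ R := by
  intro n
  induction n using Nat.strong_induction_on with
  | _ n ih =>
    intro hn
    cases n with
    | zero => simp [hD, R.zero_mem]
    | succ n =>
      have hc := congrArg (PowerSeries.coeff (n + 1)) h
      rw [PowerSeries.coeff_mul, Finset.Nat.sum_antidiagonal_succ'] at hc
      simp only [map_add, PowerSeries.coeff_zero_eq_constantCoeff, hD, hS1, zero_add,
        mul_one] at hc
      rw [eq_sub_of_add_eq hc]
      refine R.sub_mem (hT _ hn) (R.sum_mem fun p hp => ?_)
      have hp' := mem_antidiagonal.1 hp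
      -- For `p.1 = 0` the other factor contains the unknown coefficient of degree `n + 1`, but it
      -- is multiplied by the zero constant term of `D`.
      rcases Nat.eq_zero_or_pos p.1 with h0 | h0
      · rw [h0]; simp [hD, R.zero_mem]
      · exact R.mul_mem (ih _ (by omega) (by omega))
          (R.add_mem (ih _ (by omega) (by omega)) (mem_seriesSubring.1 hS _))

/-- The subring `mix` of `PolyAlg`. -/
noncomputable abbrev mixRing : Subring PolyAlg := mix.toSubring

/-- The monomial `dividedPow k * u ^ (2 ^ k)`. -/
noncomputable def dividedMonomial (k : ℕ) : PowerSeries PolyAlg :=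
  PowerSeries.monomial (2 ^ k) (dividedPow k)

theorem dividedMonomial_mem (k : ℕ) : dividedMonomial k ∈ seriesSubring mixRing := by
  refine mem_seriesSubring.2 fun n => ?_
  rw [dividedMonomial, PowerSeries.coeff_monomial]
  split_ifs
  · exact dividedPow_mem_mix k
  · exact mix.zero_mem

theorem dividedMonomial_sq (k : ℕ) :
    dividedMonomial k ^ 2 = 2 * dividedMonomial (k + 1) := by
  have h2 : (2 : PowerSeries PolyAlg) = PowerSeries.monomial 0 2 := by
    rw [PowerSeries.monomial_zero_eq_C_apply, map_ofNat]
  rw [dividedMonomial, dividedMonomial, sq, PowerSeries.monomial_mul_monomial, ← sq,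
    dividedPow_sq, h2, PowerSeries.monomial_mul_monomial, zero_add, pow_succ, mul_two]

/-- A square root of `1 + 2 ĥ_1 u` modulo `4`, up to degree `2 ^ k`. -/
noncomputable def approxSqrt (k : ℕ) : PowerSeries PolyAlg := ∏ i ∈ range k, (1 + dividedMonomial i)

theorem approxSqrt_mem (k : ℕ) : approxSqrt k ∈ seriesSubring mixRing :=
  Subring.prod_mem _ fun i _ => Subring.add_mem _ (Subring.one_mem _) (dividedMonomial_mem i)

theorem constantCoeff_approxSqrt (k : ℕ) :
    PowerSeries.constantCoeff (approxSqrt k) = 1 := by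
  rw [approxSqrt, map_prod]
  refine prod_eq_one fun i _ => ?_
  rw [map_add, map_one, dividedMonomial, ← PowerSeries.coeff_zero_eq_constantCoeff_apply,
    PowerSeries.coeff_monomial, if_neg (by positivity), add_zero]

/-- The product telescopes modulo 4: if x² = 2y, then (1 + x)²(1 + 2y) = 1 + 2x + 4(y + xy + y²). -/
theorem approxSqrt_sq (k : ℕ) : ∃ w ∈ seriesSubring mixRing,
    approxSqrt k ^ 2 * (1 + 2 * dividedMonomial k) = 1 + 2 * dividedMonomial 0 + 4 * w := by
  induction k with
  | zero => exact ⟨0, Subring.zero_mem _, by simp [approxSqrt]⟩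
  | succ k ih =>
    obtain ⟨w, hw, h⟩ := ih
    have hx := dividedMonomial_mem k
    have hy := dividedMonomial_mem (k + 1)
    have hs : approxSqrt (k + 1) = approxSqrt k * (1 + dividedMonomial k) := by
      rw [approxSqrt, prod_range_succ, approxSqrt]
    have hq := dividedMonomial_sq k
    refine ⟨w + approxSqrt k ^ 2 * (dividedMonomial (k + 1)
      + dividedMonomial k * dividedMonomial (k + 1) + dividedMonomial (k + 1) ^ 2), ?_, ?_⟩
    · exact add_mem hw (mul_mem (pow_mem (approxSqrt_mem k) 2)
        (add_mem (add_mem hy (mul_mem hx hy)) (pow_mem hy 2)))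
    · rw [hs]
      linear_combination h + approxSqrt k ^ 2 * (1 + 2 * dividedMonomial (k + 1)) * hq

theorem hatSeries_circ_sq : ∃ w ∈ seriesSubring mixRing,
    hatSeries circ ^ 2 = 1 + 2 * dividedMonomial 0 + 4 * w := by
  -- The coefficient of u^n in H(2u) is 2^n ĥ_n, divisible by 4 for n ≥ 2.
  refine ⟨PowerSeries.mk fun n => if n < 2 then 0 else 2 ^ (n - 2) * hat one n,
    mem_seriesSubring.2 fun n => ?_, ?_⟩
  · rw [PowerSeries.coeff_mk]
    split_ifs
    · exact mix.zero_mem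
    · exact mix.mul_mem (mix.pow_mem (mix.natCast_mem 2) _) (hat_one_mem_mix n)
  · rw [sq, hatSeries_circ_mul_self]
    have h2 : (2 : PowerSeries PolyAlg) = PowerSeries.C 2 := by rw [map_ofNat]
    have h4 : (4 : PowerSeries PolyAlg) = PowerSeries.C 4 := by rw [map_ofNat]
    ext1 n
    rw [h2, h4, PowerSeries.coeff_rescale, map_add, map_add, PowerSeries.coeff_C_mul,
      PowerSeries.coeff_C_mul, PowerSeries.coeff_mk, coeff_hatSeries, dividedMonomial,
      PowerSeries.coeff_monomial, PowerSeries.coeff_one, map_ofNat, dividedPow, pow_zero]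
    match n with
    | 0 => simp [hat_zero]
    | 1 => simp
    | n + 2 => simp; ring

theorem hat_circ_mem_mix (k : ℕ) : hat circ k ∈ mix := by
  obtain ⟨w₁, hw₁, h₁⟩ := approxSqrt_sq k
  obtain ⟨w₂, hw₂, h₂⟩ := hatSeries_circ_sq
  set c : PowerSeries PolyAlg := PowerSeries.C (MvPolynomial.C (1 / 2 : ℚ)) with hc
  have hc2 : c * 2 = 1 := by
    have := half_mul_two 1
    rw [mul_one] at this
    rw [hc, show (2 : PowerSeries PolyAlg) = PowerSeries.C 2 by rw [map_ofNat], ← map_mul, this,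
      map_one]
  set D := c * (hatSeries circ - approxSqrt k) with hD
  have hC : hatSeries circ = approxSqrt k + 2 * D := by
    rw [hD]; linear_combination -(hatSeries circ - approxSqrt k) * hc2
  -- A quarter of the difference of the two squares; the last term carries the denominator 2, but
  -- starts only in degree 2^k > k.
  have hDS : D * (D + approxSqrt k)
      = (w₂ - w₁) + c * approxSqrt k ^ 2 * dividedMonomial k := by
    have h4 : 4 * (D * (D + approxSqrt k))
        = 4 * ((w₂ - w₁) + c * approxSqrt k ^ 2 * dividedMonomial k) := by
      rw [hC] at h₂
      linear_combination h₂ - h₁ - 2 * approxSqrt k ^ 2 * dividedMonomial k * hc2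
    have hu : c * c * 4 = 1 := by linear_combination (c * 2 + 1) * hc2
    linear_combination c * c * h4 - (D * (D + approxSqrt k)
      - ((w₂ - w₁) + c * approxSqrt k ^ 2 * dividedMonomial k)) * hu
  have hmem := coeff_mem_of_mul_add_eq mixRing (N := 2 ^ k) (approxSqrt_mem k)
    (constantCoeff_approxSqrt k)
    (by rw [hD, map_mul, map_sub, constantCoeff_hatSeries, constantCoeff_approxSqrt]; simp)
    (fun n hn => ?_) hDS k Nat.lt_two_pow_self
  · rw [← coeff_hatSeries, hC, two_mul, map_add, map_add]
    exact mix.add_mem (mem_seriesSubring.1 (approxSqrt_mem k) k) (mix.add_mem hmem hmem)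
  · rw [map_add, dividedMonomial, PowerSeries.monomial_eq_C_mul_X_pow, ← mul_assoc,
      PowerSeries.coeff_mul_X_pow', if_neg (by omega), add_zero]
    exact mem_seriesSubring.1 (sub_mem hw₂ hw₁) n

end SquareRoot

end MixedIntegralForm

theorem mainTheorem9 (k : ℕ) :
    MixedIntegralForm.hat MixedIntegralForm.circ k ∈ MixedIntegralForm.mix :=
  MixedIntegralForm.hat_circ_mem_mix k
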